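/- Let $\Omega\subset\mathbb{R}^n$ be a bounded open set (for instance a bounded domain) that is smoothly bounded, i.e. there is a $C^\infty$ function $r:\mathbb{R}^n\to\mathbb{R}$ with $\Omega=\{r<0\}$, $\{r=0\}=b\Omega$ (the topological boundary) and $\nabla r\neq 0$ in a neighborhood of $b\Omega$. Let $\delta$ be the signed distance to the boundary, $\delta(x)=-\operatorname{dist}(x,b\Omega)$ for $x\in\Omega$ and $\delta(x)=\operatorname{dist}(x,b\Omega)$ for $x\in\mathbb{R}^n\setminus\Omega$, and write $\mathcal{H}_x=\bigl(\frac{\partial^2\delta}{\partial x_j\partial x_k}(x)\bigr)_{1\le j,k\le n}$ for its Hessian matrix. Then there is an open neighborhood $U$ of $b\Omega$ such that $\delta$ is $C^\infty$ on $U$, every $x\in U$ has a unique nearest boundary point $b(x)\in b\Omega$ (that is, $\|b(x)-x\|=|\delta(x)|$), and for every $x\in U$ the series below converges, the matrix $I+\delta(x)\mathcal{H}_{b(x)}$ is invertible, and $$\mathcal{H}_x=\mathcal{H}_{b(x)}\cdot\Bigl(\sum_{m=0}^{\infty}(-\delta(x))^m\,\mathcal{H}_{b(x)}^m\Bigr)=\mathcal{H}_{b(x)}\cdot\bigl(I+\delta(x)\mathcal{H}_{b(x)}\bigr)^{-1},$$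 where $I$ is the $n\times n$ identity matrix. -/

import Mathlib

open scoped ContDiff Topology

noncomputable section

/-- An open set `Ω ⊆ ℝⁿ` is smoothly bounded if it admits a defining function `r` on `ℝⁿ`
(that is, `Ω = {r < 0}`) of class `C^∞` such that `{r = 0}` is the boundary of `Ω` and
`∇r ≠ 0` in a neighborhood of that set. -/
def IsSmoothlyBounded {n : ℕ} (Ω : Set (EuclideanSpace ℝ (Fin n))) : Prop :=
  IsOpen Ω ∧
    ∃ r : EuclideanSpace ℝ (Fin n) → ℝ,
      ContDiff ℝ ∞ r ∧
      Ω = {x | r x < 0} ∧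
      {x | r x = 0} = frontier Ω ∧
      ∃ W : Set (EuclideanSpace ℝ (Fin n)),
        IsOpen W ∧ {x | r x = 0} ⊆ W ∧ ∀ x ∈ W, gradient r x ≠ 0

open Classical in
/-- The signed Euclidean distance to the boundary of `Ω`: negative in `Ω`, nonnegative
outside `Ω`. -/
def signedDistance {n : ℕ} (Ω : Set (EuclideanSpace ℝ (Fin n)))
    (x : EuclideanSpace ℝ (Fin n)) : ℝ :=
  if x ∈ Ω then -Metric.infDist x (frontier Ω) else Metric.infDist x (frontier Ω)

/-- The partial derivative `∂f/∂x_j`. -/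
def partialDerivative {n : ℕ} (j : Fin n) (f : EuclideanSpace ℝ (Fin n) → ℝ)
    (x : EuclideanSpace ℝ (Fin n)) : ℝ :=
  fderiv ℝ f x (EuclideanSpace.single j 1)

/-- The Hessian matrix `(∂²f/∂x_j∂x_k (x))_{j,k}`. -/
def hessianMatrix {n : ℕ} (f : EuclideanSpace ℝ (Fin n) → ℝ)
    (x : EuclideanSpace ℝ (Fin n)) : Matrix (Fin n) (Fin n) ℝ :=
  Matrix.of fun j k => partialDerivative j (partialDerivative k f) x

end

/-!
Let `∇ r ≠ 0` on the hypersurface `{r = 0}`. By Lagrange multipliers a point `x` lies on the normal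
line through each of its nearest boundary points, so the inverse function theorem for
`(y, t) ↦ (y + t ∇ r(y), r(y))` shows that near the boundary the nearest point `b(x)` is unique and
that `b` is smooth. With `ν` the unit normal at `b(x)` one has `x = b(x) + δ(x) ν(x)`; since `ν` is
orthogonal to the derivatives of `b` and of `ν`, differentiating this and pairing with `ν` gives
`∇δ = ν`. Hence `∇δ` is constant along normals, `∇δ(x) = ∇δ(x - δ(x) ∇δ(x))`. As the Hessian
`H_b` of `δ` at `b(x)` kills `∇δ(x)`, differentiating once more gives `H_x = H_b - δ(x) H_b H_x`,
which the Neumann series solves for `H_x` when `|δ(x)|` is small.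
-/

section Gradient

open scoped Gradient RealInnerProductSpace

theorem inner_fderiv_eq_zero_of_norm_eventually_eq {E F : Type*} [NormedAddCommGroup E]
    [NormedSpace ℝ E] [NormedAddCommGroup F] [InnerProductSpace ℝ F] {ν : E → F} {x : E} {c : ℝ}
    (hν : DifferentiableAt ℝ ν x) (hc : ∀ᶠ y in 𝓝 x, ‖ν y‖ = c) (v : E) :
    ⟪ν x, fderiv ℝ ν x v⟫ = 0 := by
  have hconst : HasFDerivAt (fun y => ‖ν y‖ ^ 2) (0 : E →L[ℝ] ℝ) x :=
    (hasFDerivAt_const (c ^ 2) x).congr_of_eventuallyEq (hc.mono fun y hy => by simp only [hy])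
  simpa using congr($(hν.hasFDerivAt.norm_sq.unique hconst) v)

variable {E : Type*} [NormedAddCommGroup E] [InnerProductSpace ℝ E] [CompleteSpace E]
  {f : E → ℝ} {x : E}

theorem contDiffAt_gradient {k : WithTop ℕ∞} (hf : ContDiffAt ℝ (k + 1) f x) :
    ContDiffAt ℝ k (∇ f) x :=
  (InnerProductSpace.toDual ℝ E).symm.toContinuousLinearEquiv.contDiff.contDiffAt.comp x
    (hf.fderiv_right le_rfl)

theorem continuousAt_gradient (hf : ContDiffAt ℝ 1 f x) : ContinuousAt (∇ f) x :=
  (contDiffAt_gradient (k := 0) (by simpa using hf)).continuousAt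

theorem differentiableAt_gradient (hf : ContDiffAt ℝ 2 f x) : DifferentiableAt ℝ (∇ f) x :=
  (contDiffAt_gradient (k := 1) (by simpa [one_add_one_eq_two] using hf)).differentiableAt
    one_ne_zero

theorem inner_fderiv_gradient (f : E → ℝ) (x v w : E) :
    ⟪fderiv ℝ (∇ f) x v, w⟫ = fderiv ℝ (fderiv ℝ f) x v w := by
  have hcomp : fderiv ℝ (∇ f) x =
      (InnerProductSpace.toDual ℝ E).symm.toContinuousLinearEquiv.toContinuousLinearMap ∘L
        fderiv ℝ (fderiv ℝ f) x :=
    (InnerProductSpace.toDual ℝ E).symm.toContinuousLinearEquiv.comp_fderiv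
  rw [hcomp]
  exact InnerProductSpace.toDual_symm_apply

theorem inner_fderiv_gradient_comm (hf : ContDiffAt ℝ 2 f x) (v w : E) :
    ⟪fderiv ℝ (∇ f) x v, w⟫ = ⟪v, fderiv ℝ (∇ f) x w⟫ := by
  rw [real_inner_comm _ v, inner_fderiv_gradient, inner_fderiv_gradient]
  exact hf.isSymmSndFDerivAt (by simp) v w

theorem fderiv_gradient_apply_gradient_of_norm_eventually_eq {c : ℝ} (hf : ContDiffAt ℝ 2 f x)
    (hc : ∀ᶠ y in 𝓝 x, ‖∇ f y‖ = c) : fderiv ℝ (∇ f) x (∇ f x) = 0 := by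
  refine ext_inner_right ℝ fun v => ?_
  rw [inner_fderiv_gradient_comm hf, inner_zero_left,
    inner_fderiv_eq_zero_of_norm_eventually_eq (differentiableAt_gradient hf) hc]

-- Differentiate `∇δ y = ∇δ (y - δ y • ∇δ y)`; the Hessian at the foot point kills the normal.
theorem fderiv_gradient_eq_sub_smul_mul {δ : E → ℝ} {p : E} (hx : ContDiffAt ℝ 2 δ x)
    (hp : ContDiffAt ℝ 2 δ p) (hpx : x - δ x • ∇ δ x = p) (hunit : ∀ᶠ y in 𝓝 p, ‖∇ δ y‖ = 1)
    (hfoot : ∀ᶠ y in 𝓝 x, ∇ δ (y - δ y • ∇ δ y) = ∇ δ y) :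
    fderiv ℝ (∇ δ) x =
      fderiv ℝ (∇ δ) p - δ x • (fderiv ℝ (∇ δ) p * fderiv ℝ (∇ δ) x) := by
  subst hpx
  have hker := fderiv_gradient_apply_gradient_of_norm_eventually_eq hp hunit
  rw [hfoot.self_of_nhds] at hker
  have hfoot' : HasFDerivAt (fun y => y - δ y • ∇ δ y) _ x :=
    (hasFDerivAt_id x).sub ((hx.differentiableAt two_ne_zero).hasFDerivAt.smul
      (differentiableAt_gradient hx).hasFDerivAt)
  have hchain := ((differentiableAt_gradient hp).hasFDerivAt.comp x hfoot').congr_of_eventuallyEq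
    (hfoot.mono fun _ hy => hy.symm)
  ext v
  rw [congr($(hchain.fderiv) v)]
  simp [hker]

-- Differentiate `x = b x + δ x • ν x` and pair with `ν x`.
theorem gradient_eq_of_eventually_eq_add_smul {δ : E → ℝ} {b ν : E → E}
    (hδ : DifferentiableAt ℝ δ x) (hb : DifferentiableAt ℝ b x) (hν : DifferentiableAt ℝ ν x)
    (hdec : ∀ᶠ y in 𝓝 x, y = b y + δ y • ν y) (hunit : ∀ᶠ y in 𝓝 x, ‖ν y‖ = 1)
    (hperp : ∀ v, ⟪ν x, fderiv ℝ b x v⟫ = 0) : ∇ δ x = ν x := by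
  have hid := (hasFDerivAt_id x).unique
    ((hb.hasFDerivAt.add (hδ.hasFDerivAt.smul hν.hasFDerivAt)).congr_of_eventuallyEq hdec)
  refine ext_inner_right ℝ fun v => ?_
  have hpair := congr(⟪ν x, $hid v⟫)
  simp only [ContinuousLinearMap.id_apply, add_apply, smul_apply,
    ContinuousLinearMap.smulRight_apply, inner_add_right, inner_smul_right, hperp,
    inner_fderiv_eq_zero_of_norm_eventually_eq hν hunit, real_inner_self_eq_norm_sq,
    hunit.self_of_nhds] at hpair
  rw [inner_gradient_left, hpair]
  ring

end Gradient

section NearestPoint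

open Filter

variable {X : Type*} [PseudoMetricSpace X]

/-- `q` is a point of `s` nearest to `x`. -/
def IsNearestPoint (s : Set X) (x q : X) : Prop :=
  q ∈ s ∧ Metric.infDist x s = dist x q

namespace IsNearestPoint

variable {s : Set X} {x p q : X}

theorem dist_le (hq : IsNearestPoint s x q) (hp : p ∈ s) : dist x q ≤ dist x p :=
  hq.2 ▸ Metric.infDist_le_dist_of_mem hp

theorem eq_of_mem {Y : Type*} [MetricSpace Y] {s : Set Y} {x q : Y} (hq : IsNearestPoint s x q)
    (hx : x ∈ s) : q = x :=
  (dist_le_zero.1 ((hq.dist_le hx).trans_eq (dist_self x))).symm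

theorem eventually_forall (hp : p ∈ s) {P : X × X → Prop} (hP : ∀ᶠ z in 𝓝 (p, p), P z) :
    ∀ᶠ x in 𝓝 p, ∀ q, IsNearestPoint s x q → P (x, q) := by
  obtain ⟨ε, hε, hball⟩ := Metric.eventually_nhds_iff_ball.1 hP
  filter_upwards [Metric.ball_mem_nhds p (half_pos hε)] with x hx q hq
  have hxp : dist x p < ε / 2 := hx
  have hqp : dist q p < ε := by
    linarith [dist_triangle_left q p x, hq.dist_le hp]
  exact hball _ (Prod.dist_eq.trans_lt (max_lt (by simpa using by linarith) hqp))

theorem tendsto {b : X → X} (hb : ∀ x, IsNearestPoint s x (b x)) (hp : p ∈ s) :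
    Tendsto b (𝓝 p) (𝓝 p) := fun _ hU =>
  (eventually_forall hp (continuous_snd.continuousAt.eventually hU)).mono fun x hx => hx _ (hb x)

end IsNearestPoint

end NearestPoint

section InverseFunction

open Filter

variable {𝕜 E F : Type*} [RCLike 𝕜] [NormedAddCommGroup E] [NormedSpace 𝕜 E] [CompleteSpace E]
  [NormedAddCommGroup F] [NormedSpace 𝕜 F] {f : E → F} {f' : E ≃L[𝕜] F} {a : E}
  {k : WithTop ℕ∞}

theorem exists_eventually_leftInverse_contDiffAt (hf : ContDiff 𝕜 k f) (hk : k ≠ 0)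
    (hf' : HasFDerivAt f (f' : E →L[𝕜] F) a) :
    ∃ g : F → E, (∀ᶠ z in 𝓝 a, g (f z) = z) ∧ ∀ᶠ w in 𝓝 (f a), ContDiffAt 𝕜 k g w := by
  let Φ := hf.contDiffAt.toOpenPartialHomeomorph f hf' hk
  have ha : a ∈ Φ.source := hf.contDiffAt.mem_toOpenPartialHomeomorph_source hf' hk
  have hfa : f a ∈ Φ.target := Φ.map_source ha
  have hinvertible : ∀ᶠ z in 𝓝 a, ∃ e : E ≃L[𝕜] F, e = fderiv 𝕜 f z :=
    (hf.continuous_fderiv hk).continuousAt.eventually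
      (ContinuousLinearEquiv.isOpen.mem_nhds ⟨f', hf'.fderiv.symm⟩)
  have hsymm : Tendsto Φ.symm (𝓝 (f a)) (𝓝 a) := by
    simpa only [ContinuousAt, show Φ.symm (f a) = a from Φ.left_inv ha]
      using Φ.continuousAt_symm hfa
  refine ⟨Φ.symm, eventually_of_mem (Φ.open_source.mem_nhds ha) fun z hz => Φ.left_inv hz, ?_⟩
  filter_upwards [Φ.open_target.mem_nhds hfa, hsymm.eventually hinvertible] with w hw ⟨e, he⟩
  exact Φ.contDiffAt_symm hw (he ▸ (hf.differentiable hk _).hasFDerivAt) hf.contDiffAt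

end InverseFunction

section NormalMap

open Filter
open scoped Gradient RealInnerProductSpace

variable {E : Type*} [NormedAddCommGroup E] [InnerProductSpace ℝ E]

theorem exists_continuousLinearEquiv_add_smul_inner {g : E} (hg : g ≠ 0) :
    ∃ e : (E × ℝ) ≃L[ℝ] E × ℝ, ∀ v s, e (v, s) = (v + s • g, ⟪g, v⟫) := by
  let fst := ContinuousLinearMap.fst ℝ E ℝ
  let snd := ContinuousLinearMap.snd ℝ E ℝ
  let coeff : E × ℝ →L[ℝ] ℝ := (‖g‖ ^ 2)⁻¹ • (innerSL ℝ g ∘L fst - snd)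
  have hg2 : ‖g‖ ^ 2 ≠ 0 := by simpa using hg
  refine ⟨ContinuousLinearEquiv.equivOfInverse
    ((fst + snd.smulRight g).prod (innerSL ℝ g ∘L fst))
    ((fst - coeff.smulRight g).prod coeff) ?_ ?_, fun v s => rfl⟩
  · rintro ⟨v, s⟩
    have hcoeff : coeff (v + s • g, ⟪g, v⟫) = s := by
      suffices (‖g‖ ^ 2)⁻¹ * (s * ‖g‖ ^ 2) = s by
        simpa [coeff, fst, snd, inner_add_right, inner_smul_right]
      rw [mul_comm s, inv_mul_cancel_left₀ hg2]
    simp [fst, snd, hcoeff]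
  · rintro ⟨w, a⟩
    have hinner : ⟪g, w - coeff (w, a) • g⟫ = a := by
      suffices ⟪g, w⟫ - (‖g‖ ^ 2)⁻¹ * (⟪g, w⟫ - a) * ‖g‖ ^ 2 = a by
        simpa [coeff, fst, snd, inner_sub_right, inner_smul_right]
      rw [mul_right_comm, inv_mul_cancel₀ hg2, one_mul, sub_sub_cancel]
    simp [fst, snd, hinner]

theorem eventually_forall_eq_add_smul {g : E → E} {p : E} (hg : ContinuousAt g p) (hgp : g p ≠ 0)
    {P : E × ℝ → Prop} (hP : ∀ᶠ z in 𝓝 (p, 0), P z) :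
    ∀ᶠ z : E × E in 𝓝 (p, p), ∀ t : ℝ, z.1 = z.2 + t • g z.2 → P (z.2, t) := by
  have hg₂ : ContinuousAt (fun z : E × E => g z.2) (p, p) := hg.comp continuousAt_snd
  have hparam : Tendsto (fun z : E × E => (z.2, ⟪g z.2, z.1 - z.2⟫ / ‖g z.2‖ ^ 2))
      (𝓝 (p, p)) (𝓝 (p, 0)) := by
    have hcont : ContinuousAt (fun z : E × E => (z.2, ⟪g z.2, z.1 - z.2⟫ / ‖g z.2‖ ^ 2)) (p, p) :=
      continuousAt_snd.prodMk ((hg₂.inner (continuousAt_fst.sub continuousAt_snd)).div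
        (hg₂.norm.pow 2) (by simpa using hgp))
    simpa [ContinuousAt] using hcont
  filter_upwards [hparam.eventually hP, hg₂.eventually_ne hgp] with z hz hgz t ht
  have hparam_eq : ⟪g z.2, z.1 - z.2⟫ / ‖g z.2‖ ^ 2 = t := by
    rw [ht, add_sub_cancel_left, inner_smul_right, real_inner_self_eq_norm_sq,
      mul_div_cancel_right₀ _ (by simpa using hgz)]
  rwa [hparam_eq] at hz

variable [CompleteSpace E] {r : E → ℝ} {p x q : E} {k : WithTop ℕ∞}

/-- The normal map of the level sets of `r`: the point at parameter `t` on the line through `y`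
in the direction `∇ r y`, paired with the level `r y` so that source and target have the same
dimension. -/
noncomputable def normalMap (r : E → ℝ) (z : E × ℝ) : E × ℝ :=
  (z.1 + z.2 • ∇ r z.1, r z.1)

theorem contDiff_normalMap (hr : ContDiff ℝ (k + 1) r) : ContDiff ℝ k (normalMap r) := by
  have hgrad : ContDiff ℝ k (∇ r) :=
    contDiff_iff_contDiffAt.2 fun _ => contDiffAt_gradient hr.contDiffAt
  exact (contDiff_fst.add (contDiff_snd.smul (hgrad.comp contDiff_fst))).prodMk
    ((hr.of_le le_self_add).comp contDiff_fst)

theorem exists_equiv_hasFDerivAt_normalMap (hr : ContDiffAt ℝ 2 r p) (hp : ∇ r p ≠ 0) :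
    ∃ e : (E × ℝ) ≃L[ℝ] E × ℝ,
      HasFDerivAt (normalMap r) (e : E × ℝ →L[ℝ] E × ℝ) (p, 0) := by
  obtain ⟨e, he⟩ := exists_continuousLinearEquiv_add_smul_inner hp
  have hgrad : HasFDerivAt (∇ r) (fderiv ℝ (∇ r) p) (p, (0 : ℝ)).1 :=
    (differentiableAt_gradient hr).hasFDerivAt
  have hr' : HasFDerivAt r (fderiv ℝ r p) (p, (0 : ℝ)).1 :=
    (hr.differentiableAt two_ne_zero).hasFDerivAt
  refine ⟨e, ((hasFDerivAt_fst.add (hasFDerivAt_snd.smul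
    (hgrad.comp _ hasFDerivAt_fst))).prodMk (hr'.comp _ hasFDerivAt_fst)).congr_fderiv ?_⟩
  refine ContinuousLinearMap.ext fun ⟨v, s⟩ => ?_
  simp [he]

theorem IsNearestPoint.exists_eq_add_smul_gradient {c : ℝ} (hr : ContDiffAt ℝ 1 r q)
    (hq : IsNearestPoint {y | r y = c} x q) (hgrad : ∇ r q ≠ 0) :
    ∃ t : ℝ, x = q + t • ∇ r q := by
  have hextr : IsLocalExtrOn (fun y => ‖y - x‖ ^ 2) {y | r y = r q} q := by
    refine Or.inl (eventually_of_mem self_mem_nhdsWithin fun y hy => ?_)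
    have hdist := hq.dist_le (hy.trans hq.1)
    rw [dist_eq_norm', dist_eq_norm'] at hdist
    exact pow_le_pow_left₀ (norm_nonneg _) hdist 2
  have hsq : HasStrictFDerivAt (fun y => ‖y - x‖ ^ 2) (2 • innerSL ℝ (q - x)) q :=
    (hasStrictFDerivAt_norm_sq (q - x)).comp q ((hasStrictFDerivAt_id q).sub_const x)
  obtain ⟨a, b, hab, hLagrange⟩ :=
    hextr.exists_multipliers_of_hasStrictFDerivAt_1d (hr.hasStrictFDerivAt one_ne_zero) hsq
  have hvec : a • ∇ r q = (2 * b) • (x - q) := by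
    refine ext_inner_right ℝ fun v => ?_
    have hv := congr($hLagrange v)
    simp only [add_apply, smul_apply, smul_eq_mul, innerSL_apply_apply, zero_apply,
      nsmul_eq_mul, Nat.cast_ofNat] at hv
    rw [← neg_sub q x, real_inner_smul_left, real_inner_smul_left, inner_neg_left,
      inner_gradient_left]
    linarith
  have hb : b ≠ 0 := by
    rintro rfl
    exact hab (by simpa [hgrad] using hvec)
  refine ⟨(2 * b)⁻¹ * a, ?_⟩
  rw [mul_smul, hvec, inv_smul_smul₀ (by simpa using hb), add_sub_cancel]

-- `r z.1 - r z.2` differs from `t * ⟪∇ r p, ∇ r z.2⟫` by less than the latter's absolute value.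
theorem eventually_mul_sub_pos_of_eq_add_smul_gradient (hr : ContDiffAt ℝ 1 r p)
    (hp : ∇ r p ≠ 0) :
    ∀ᶠ z : E × E in 𝓝 (p, p), ∀ t ≠ 0, z.1 = z.2 + t • ∇ r z.2 → 0 < t * (r z.1 - r z.2) := by
  have hgrad : ContinuousAt (fun z : E × E => ∇ r z.2) (p, p) :=
    ContinuousAt.comp' (continuousAt_gradient hr) continuousAt_snd
  have hnorm : 0 < ‖∇ r p‖ := norm_pos_iff.2 hp
  have hstrict : ∀ᶠ z : E × E in 𝓝 (p, p),
      ‖r z.1 - r z.2 - fderiv ℝ r p (z.1 - z.2)‖ ≤ ‖∇ r p‖ / 2 * ‖z.1 - z.2‖ :=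
    (hr.hasStrictFDerivAt one_ne_zero).isLittleO.def (half_pos hnorm)
  have hangle : ∀ᶠ z : E × E in 𝓝 (p, p), ‖∇ r p‖ / 2 * ‖∇ r z.2‖ < ⟪∇ r p, ∇ r z.2⟫ := by
    refine (continuousAt_const.mul hgrad.norm).eventually_lt (continuousAt_const.inner hgrad) ?_
    change ‖∇ r p‖ / 2 * ‖∇ r p‖ < ⟪∇ r p, ∇ r p⟫
    rw [real_inner_self_eq_norm_sq]
    nlinarith
  filter_upwards [hstrict, hangle] with z hz hlt t ht hzt
  rw [show z.1 - z.2 = t • ∇ r z.2 by rw [hzt, add_sub_cancel_left], map_smul,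
    ← inner_gradient_left, smul_eq_mul, norm_smul, Real.norm_eq_abs, Real.norm_eq_abs] at hz
  have herror : |t * (r z.1 - r z.2 - t * ⟪∇ r p, ∇ r z.2⟫)| < t ^ 2 * ⟪∇ r p, ∇ r z.2⟫ := by
    rw [abs_mul, ← sq_abs t]
    calc |t| * |r z.1 - r z.2 - t * ⟪∇ r p, ∇ r z.2⟫|
        ≤ |t| * (‖∇ r p‖ / 2 * (|t| * ‖∇ r z.2‖)) := by gcongr
      _ = |t| ^ 2 * (‖∇ r p‖ / 2 * ‖∇ r z.2‖) := by ring
      _ < |t| ^ 2 * ⟪∇ r p, ∇ r z.2⟫ := mul_lt_mul_of_pos_left hlt (pow_pos (abs_pos.2 ht) 2)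
  linarith [(abs_lt.1 herror).1]

theorem exists_contDiffAt_nearestPoint (hr : ContDiff ℝ (k + 1) r) (hk : k ≠ 0) (hp : r p = 0)
    (hgrad : ∇ r p ≠ 0) :
    ∃ y : E → E, (∀ᶠ x in 𝓝 p, ContDiffAt ℝ k y x) ∧
      ∀ᶠ x in 𝓝 p, ∀ q, IsNearestPoint {y | r y = 0} x q → q = y x := by
  have hk1 : 1 ≤ k := ENat.one_le_iff_ne_zero_withTop.2 hk
  have hr1 : ContDiff ℝ 1 r := hr.of_le (hk1.trans le_self_add)
  have hr2 : ContDiff ℝ 2 r := hr.of_le (by simpa [one_add_one_eq_two] using add_le_add_left hk1 1)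
  obtain ⟨e, he⟩ := exists_equiv_hasFDerivAt_normalMap hr2.contDiffAt hgrad
  obtain ⟨g, hg_left, hg⟩ := exists_eventually_leftInverse_contDiffAt (contDiff_normalMap hr) hk he
  have hgradc : ContinuousAt (∇ r) p := continuousAt_gradient hr1.contDiffAt
  have hgradc₂ : ContinuousAt (fun z : E × E => ∇ r z.2) (p, p) :=
    ContinuousAt.comp' hgradc continuousAt_snd
  refine ⟨fun x => (g (x, 0)).1, ?_, ?_⟩
  · have hembed : Tendsto (fun x : E => (x, (0 : ℝ))) (𝓝 p) (𝓝 (normalMap r (p, 0))) := by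
      simpa [normalMap, hp] using (Continuous.prodMk_left (0 : ℝ)).tendsto p
    filter_upwards [hembed.eventually hg] with x hx
    exact (hx.comp x (contDiff_prodMk_left 0).contDiffAt).fst
  · filter_upwards [IsNearestPoint.eventually_forall (s := {y | r y = 0}) hp
      ((hgradc₂.eventually_ne hgrad).and (eventually_forall_eq_add_smul hgradc hgrad hg_left))]
      with x hx q hq
    obtain ⟨hgradq, hinv⟩ := hx q hq
    obtain ⟨t, ht⟩ := hq.exists_eq_add_smul_gradient hr1.contDiffAt hgradq
    have hqt : normalMap r (q, t) = (x, 0) := Prod.ext ht.symm hq.1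
    rw [← hqt, hinv t ht]

end NormalMap

section SignedDistance

/-- `δ` is the distance to the zero set of `r`, up to a sign that agrees with the sign of `r`. -/
structure IsSignedDistance {X : Type*} [PseudoMetricSpace X] (r δ : X → ℝ) : Prop where
  abs_eq : ∀ x, |δ x| = Metric.infDist x {y | r y = 0}
  zero_le_mul : ∀ x, 0 ≤ δ x * r x

theorem IsSignedDistance.eq_zero {X : Type*} [PseudoMetricSpace X] {r δ : X → ℝ} {x : X}
    (hδ : IsSignedDistance r δ) (hx : r x = 0) : δ x = 0 := by
  rw [← abs_eq_zero, hδ.abs_eq]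
  exact Metric.infDist_zero_of_mem hx

theorem eq_of_abs_eq_abs_of_mul_nonneg {R : Type*} [Ring R] [LinearOrder R] [IsStrictOrderedRing R]
    {a b : R} (habs : |a| = |b|) (hab : 0 ≤ a * b) : a = b := by
  obtain h | rfl := abs_eq_abs.1 habs
  · exact h
  · rw [neg_mul, neg_nonneg] at hab
    simp [mul_self_eq_zero.1 (hab.antisymm (mul_self_nonneg b))]

open Filter
open scoped Gradient RealInnerProductSpace

variable {E : Type*} [NormedAddCommGroup E] [InnerProductSpace ℝ E] [CompleteSpace E]
  {r δ : E → ℝ} {b : E → E} {p x : E} {k : WithTop ℕ∞}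

/-- The unit normal of the level set of `r` through `y`, pointing to higher levels; it is `0` at
critical points of `r`. -/
noncomputable def unitNormal (r : E → ℝ) (y : E) : E :=
  ‖∇ r y‖⁻¹ • ∇ r y

theorem norm_unitNormal (hgrad : ∇ r x ≠ 0) : ‖unitNormal r x‖ = 1 :=
  norm_smul_inv_norm (𝕜 := ℝ) hgrad

theorem contDiffAt_unitNormal (hr : ContDiffAt ℝ (k + 1) r x) (hgrad : ∇ r x ≠ 0) :
    ContDiffAt ℝ k (unitNormal r) x :=
  have hgradient := contDiffAt_gradient hr
  ((hgradient.norm ℝ hgrad).inv (norm_ne_zero_iff.2 hgrad)).smul hgradient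

theorem eventually_gradient_nearestPoint_ne_zero (hr : ContDiffAt ℝ 1 r p) (hp : r p = 0)
    (hgrad : ∇ r p ≠ 0) (hb : ∀ x, IsNearestPoint {y | r y = 0} x (b x)) :
    ∀ᶠ x in 𝓝 p, ∇ r (b x) ≠ 0 :=
  (IsNearestPoint.tendsto hb hp).eventually ((continuousAt_gradient hr).eventually_ne hgrad)

theorem IsSignedDistance.eventually_eq_mul_norm_gradient (hδ : IsSignedDistance r δ)
    (hr : ContDiffAt ℝ 1 r p) (hgrad : ∇ r p ≠ 0) :
    ∀ᶠ z : E × E in 𝓝 (p, p), IsNearestPoint {y | r y = 0} z.1 z.2 →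
      ∀ t : ℝ, z.1 = z.2 + t • ∇ r z.2 → δ z.1 = t * ‖∇ r z.2‖ := by
  filter_upwards [eventually_mul_sub_pos_of_eq_add_smul_gradient hr hgrad] with z hz hq t ht
  have habs : |δ z.1| = |t * ‖∇ r z.2‖| := by
    rw [hδ.abs_eq, hq.2, dist_eq_norm, sub_eq_of_eq_add' ht, norm_smul, abs_mul, abs_norm,
      Real.norm_eq_abs]
  obtain rfl | ht0 := eq_or_ne t 0
  · simpa using habs
  have htr : 0 < t * r z.1 := by simpa [show r z.2 = 0 from hq.1] using hz t ht0 ht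
  have hδt : 0 ≤ δ z.1 * t := by
    refine nonneg_of_mul_nonneg_left ?_ (mul_self_pos.2 (right_ne_zero_of_mul htr.ne'))
    rw [mul_mul_mul_comm]
    exact mul_nonneg (hδ.zero_le_mul z.1) htr.le
  refine eq_of_abs_eq_abs_of_mul_nonneg habs ?_
  rw [← mul_assoc]
  exact mul_nonneg hδt (norm_nonneg _)

theorem IsSignedDistance.eventually_eq_add_smul_unitNormal (hδ : IsSignedDistance r δ)
    (hr : ContDiff ℝ 1 r) (hp : r p = 0) (hgrad : ∇ r p ≠ 0)
    (hb : ∀ x, IsNearestPoint {y | r y = 0} x (b x)) :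
    ∀ᶠ x in 𝓝 p, x = b x + δ x • unitNormal r (b x) := by
  filter_upwards [IsNearestPoint.eventually_forall (s := {y | r y = 0}) hp
      (hδ.eventually_eq_mul_norm_gradient hr.contDiffAt hgrad),
    eventually_gradient_nearestPoint_ne_zero hr.contDiffAt hp hgrad hb] with x hx hbx
  obtain ⟨t, ht⟩ := (hb x).exists_eq_add_smul_gradient hr.contDiffAt hbx
  rw [hx _ (hb x) (hb x) t ht, unitNormal, smul_smul, mul_assoc,
    mul_inv_cancel₀ (norm_ne_zero_iff.2 hbx), mul_one, ← ht]

theorem eventually_contDiffAt_nearestPoint (hr : ContDiff ℝ (k + 1) r) (hk : k ≠ 0) (hp : r p = 0)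
    (hgrad : ∇ r p ≠ 0) (hb : ∀ x, IsNearestPoint {y | r y = 0} x (b x)) :
    ∀ᶠ x in 𝓝 p, ContDiffAt ℝ k b x := by
  obtain ⟨y, hy, hby⟩ := exists_contDiffAt_nearestPoint hr hk hp hgrad
  filter_upwards [hy, (hby.mono fun x hx => hx _ (hb x)).eventually_nhds] with x hyx hbx
  exact hyx.congr_of_eventuallyEq hbx

theorem eventually_isNearestPoint_unique (hr : ContDiff ℝ (k + 1) r) (hk : k ≠ 0) (hp : r p = 0)
    (hgrad : ∇ r p ≠ 0) (hb : ∀ x, IsNearestPoint {y | r y = 0} x (b x)) :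
    ∀ᶠ x in 𝓝 p, ∀ q, IsNearestPoint {y | r y = 0} x q → q = b x := by
  obtain ⟨y, -, hby⟩ := exists_contDiffAt_nearestPoint hr hk hp hgrad
  exact hby.mono fun x hx q hq => (hx q hq).trans (hx _ (hb x)).symm

theorem IsSignedDistance.eventually_contDiffAt (hδ : IsSignedDistance r δ)
    (hr : ContDiff ℝ (k + 1) r) (hk : k ≠ 0) (hp : r p = 0) (hgrad : ∇ r p ≠ 0)
    (hb : ∀ x, IsNearestPoint {y | r y = 0} x (b x)) :
    ∀ᶠ x in 𝓝 p, ContDiffAt ℝ k δ x := by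
  have hr1 : ContDiff ℝ 1 r := hr.of_le le_add_self
  have hgradb := eventually_gradient_nearestPoint_ne_zero hr1.contDiffAt hp hgrad hb
  have hinner : ∀ᶠ x in 𝓝 p, δ x = ⟪x - b x, unitNormal r (b x)⟫ := by
    filter_upwards [hδ.eventually_eq_add_smul_unitNormal hr1 hp hgrad hb, hgradb] with x hx hbx
    rw [sub_eq_of_eq_add' hx, real_inner_smul_left, real_inner_self_eq_norm_sq,
      norm_unitNormal hbx, one_pow, mul_one]
  filter_upwards [hinner.eventually_nhds, hgradb,
    eventually_contDiffAt_nearestPoint hr hk hp hgrad hb] with x hx hgradx hbx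
  exact ((contDiffAt_id.sub hbx).inner ℝ
    ((contDiffAt_unitNormal hr.contDiffAt hgradx).comp x hbx)).congr_of_eventuallyEq hx

theorem inner_unitNormal_fderiv_eq_zero {c : ℝ} (hr : DifferentiableAt ℝ r (b x))
    (hb : DifferentiableAt ℝ b x) (hlevel : ∀ y, r (b y) = c) (v : E) :
    ⟪unitNormal r (b x), fderiv ℝ b x v⟫ = 0 := by
  have hconst : HasFDerivAt (r ∘ b) (0 : E →L[ℝ] ℝ) x := by
    simpa only [show r ∘ b = fun _ => c from funext hlevel] using hasFDerivAt_const c x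
  have hv : fderiv ℝ r (b x) (fderiv ℝ b x v) = 0 :=
    congr($((hr.hasFDerivAt.comp x hb.hasFDerivAt).unique hconst) v)
  rw [unitNormal, real_inner_smul_left, inner_gradient_left, hv, mul_zero]

theorem IsSignedDistance.eventually_gradient_eq (hδ : IsSignedDistance r δ)
    (hr : ContDiff ℝ 2 r) (hp : r p = 0) (hgrad : ∇ r p ≠ 0)
    (hb : ∀ x, IsNearestPoint {y | r y = 0} x (b x)) :
    ∀ᶠ x in 𝓝 p, ∇ δ x = unitNormal r (b x) := by
  have hr1 : ContDiff ℝ 1 r := hr.of_le one_le_two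
  have hr11 : ContDiff ℝ (1 + 1) r := by rwa [one_add_one_eq_two]
  have hgradb := eventually_gradient_nearestPoint_ne_zero hr1.contDiffAt hp hgrad hb
  filter_upwards [hδ.eventually_contDiffAt hr11 one_ne_zero hp hgrad hb,
    eventually_contDiffAt_nearestPoint hr11 one_ne_zero hp hgrad hb, hgradb,
    (hδ.eventually_eq_add_smul_unitNormal hr1 hp hgrad hb).eventually_nhds,
    (hgradb.mono fun _ => norm_unitNormal).eventually_nhds] with x hδx hbx hgradx hdec hunit
  have hb' : DifferentiableAt ℝ b x := hbx.differentiableAt one_ne_zero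
  have hν : DifferentiableAt ℝ (fun y => unitNormal r (b y)) x :=
    ((contDiffAt_unitNormal hr11.contDiffAt hgradx).differentiableAt one_ne_zero).comp x hb'
  exact gradient_eq_of_eventually_eq_add_smul (hδx.differentiableAt one_ne_zero) hb' hν hdec hunit
    (inner_unitNormal_fderiv_eq_zero (hr1.contDiffAt.differentiableAt one_ne_zero) hb'
      fun y => (hb y).1)

theorem IsSignedDistance.eventually_fderiv_gradient_eq (hδ : IsSignedDistance r δ)
    (hr : ContDiff ℝ 3 r) (hp : r p = 0) (hgrad : ∇ r p ≠ 0)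
    (hb : ∀ x, IsNearestPoint {y | r y = 0} x (b x)) :
    ∀ᶠ x in 𝓝 p, fderiv ℝ (∇ δ) x =
      fderiv ℝ (∇ δ) (b x) - δ x • (fderiv ℝ (∇ δ) (b x) * fderiv ℝ (∇ δ) x) := by
  have hr1 : ContDiff ℝ 1 r := hr.of_le (by norm_num)
  have hr21 : ContDiff ℝ (2 + 1) r := by rwa [two_add_one_eq_three]
  have hδ2 := hδ.eventually_contDiffAt hr21 two_ne_zero hp hgrad hb
  have hgradδ := hδ.eventually_gradient_eq (hr.of_le (by norm_num)) hp hgrad hb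
  have hunit : ∀ᶠ x in 𝓝 p, ‖∇ δ x‖ = 1 := by
    filter_upwards [hgradδ, eventually_gradient_nearestPoint_ne_zero hr1.contDiffAt hp hgrad hb]
      with x hx hbx
    rw [hx, norm_unitNormal hbx]
  have hbp := IsNearestPoint.tendsto hb hp
  have hnormal : ∀ᶠ x in 𝓝 p, x - δ x • ∇ δ x = b x := by
    filter_upwards [hδ.eventually_eq_add_smul_unitNormal hr1 hp hgrad hb, hgradδ] with x hx hgradx
    rwa [hgradx, sub_eq_iff_eq_add]
  have hfoot : ∀ᶠ x in 𝓝 p, ∇ δ (x - δ x • ∇ δ x) = ∇ δ x := by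
    filter_upwards [hnormal, hgradδ, hbp.eventually hgradδ] with x hx hgradx hgradbx
    rw [hx, hgradbx, hgradx, (hb (b x)).eq_of_mem (hb x).1]
  filter_upwards [hδ2, hbp.eventually hδ2, hnormal, hbp.eventually hunit.eventually_nhds,
    hfoot.eventually_nhds] with x hx hbx hnormalx hunitx hfootx
  exact fderiv_gradient_eq_sub_smul_mul hx hbx hnormalx hunitx hfootx

theorem IsSignedDistance.eventually_norm_smul_fderiv_gradient_lt_one (hδ : IsSignedDistance r δ)
    (hr : ContDiff ℝ 3 r) (hp : r p = 0) (hgrad : ∇ r p ≠ 0)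
    (hb : ∀ x, IsNearestPoint {y | r y = 0} x (b x)) :
    ∀ᶠ x in 𝓝 p, ‖δ x • fderiv ℝ (∇ δ) (b x)‖ < 1 := by
  have hr21 : ContDiff ℝ (2 + 1) r := by rwa [two_add_one_eq_three]
  have hδ2 : ContDiffAt ℝ 2 δ p :=
    (hδ.eventually_contDiffAt hr21 two_ne_zero hp hgrad hb).self_of_nhds
  have hH : ContinuousAt (fderiv ℝ (∇ δ)) p :=
    (contDiffAt_gradient (k := 1) (by rwa [one_add_one_eq_two])).continuousAt_fderiv one_ne_zero
  have hlim : Tendsto (fun x => δ x • fderiv ℝ (∇ δ) (b x)) (𝓝 p) (𝓝 0) := by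
    simpa only [hδ.eq_zero hp, zero_smul, Function.comp_def] using
      hδ2.continuousAt.tendsto.smul (hH.tendsto.comp (IsNearestPoint.tendsto hb hp))
  exact hlim.norm.eventually_lt_const (by simp)

end SignedDistance

section Neumann

variable {𝕜 𝔸 : Type*}

theorem eq_mul_inverse_of_eq_sub_smul_mul [CommRing 𝕜] [Ring 𝔸] [Algebra 𝕜 𝔸] {A B : 𝔸} {d : 𝕜}
    (h : A = B - d • (B * A)) (hu : IsUnit (1 + d • B)) : A = B * Ring.inverse (1 + d • B) := by
  have hcomm : Commute B (1 + d • B) :=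
    (Commute.one_right B).add_right ((Commute.refl B).smul_right d)
  have hmul : (1 + d • B) * A = B := by
    rwa [add_mul, one_mul, smul_mul_assoc, ← eq_sub_iff_add_eq]
  refine (Ring.eq_mul_inverse_iff_mul_eq _ _ _ hu).2 (hu.mul_left_cancel ?_)
  rw [← mul_assoc, hmul, hcomm.eq]

theorem eq_mul_tsum_of_eq_sub_smul_mul [NormedField 𝕜] [NormedRing 𝔸] [CompleteSpace 𝔸]
    [NormedAlgebra 𝕜 𝔸] {A B : 𝔸} {d : 𝕜} (h : A = B - d • (B * A)) (hd : ‖d • B‖ < 1) :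
    Summable (fun m : ℕ => (-d) ^ m • B ^ m) ∧ A = B * ∑' m : ℕ, (-d) ^ m • B ^ m ∧
      IsUnit (1 + d • B) ∧ A = B * Ring.inverse (1 + d • B) := by
  have hpow : (fun m : ℕ => (-d) ^ m • B ^ m) = fun m => (-(d • B)) ^ m := by
    simp only [← smul_pow, neg_smul]
  have hd' : ‖-(d • B)‖ < 1 := by rwa [norm_neg]
  have hu : IsUnit (1 + d • B) := by
    simpa only [sub_neg_eq_add] using isUnit_one_sub_of_norm_lt_one hd'
  have htsum : ∑' m : ℕ, (-(d • B)) ^ m = Ring.inverse (1 + d • B) := by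
    rw [← sub_neg_eq_add, NormedRing.inverse_one_sub _ hd']
    rfl
  have hA := eq_mul_inverse_of_eq_sub_smul_mul h hu
  exact ⟨hpow ▸ summable_geometric_of_norm_lt_one hd', by rwa [hpow, htsum], hu, hA⟩

end Neumann

section Hessian

open scoped Gradient Matrix.Norms.L2Operator RealInnerProductSpace

variable {n : ℕ}

theorem hessianMatrix_apply {f : EuclideanSpace ℝ (Fin n) → ℝ} {x : EuclideanSpace ℝ (Fin n)}
    (hf : ContDiffAt ℝ 2 f x) (j k : Fin n) :
    hessianMatrix f x j k = fderiv ℝ (∇ f) x (EuclideanSpace.single k 1) j := by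
  have hf' : DifferentiableAt ℝ (fderiv ℝ f) x :=
    (hf.fderiv_right (m := 1) one_add_one_eq_two.le).differentiableAt one_ne_zero
  calc hessianMatrix f x j k
      = fderiv ℝ (fderiv ℝ f) x (EuclideanSpace.single j 1) (EuclideanSpace.single k 1) :=
        congr($((hf'.hasFDerivAt.clm_apply (hasFDerivAt_const _ x)).fderiv) _).trans (by simp)
    _ = ⟪EuclideanSpace.single j 1, fderiv ℝ (∇ f) x (EuclideanSpace.single k 1)⟫ := by
        rw [← inner_fderiv_gradient, inner_fderiv_gradient_comm hf]
    _ = fderiv ℝ (∇ f) x (EuclideanSpace.single k 1) j := by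
        simp [EuclideanSpace.inner_single_left]

theorem toEuclideanCLM_hessianMatrix {f : EuclideanSpace ℝ (Fin n) → ℝ}
    {x : EuclideanSpace ℝ (Fin n)} (hf : ContDiffAt ℝ 2 f x) :
    Matrix.toEuclideanCLM (n := Fin n) (𝕜 := ℝ) (hessianMatrix f x) = fderiv ℝ (∇ f) x := by
  refine ContinuousLinearMap.coe_injective
    ((EuclideanSpace.basisFun (Fin n) ℝ).toBasis.ext fun k => ?_)
  ext j
  simp [hessianMatrix_apply hf]

theorem IsSignedDistance.eventually_hessianMatrix_eq {r δ : EuclideanSpace ℝ (Fin n) → ℝ}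
    {b : EuclideanSpace ℝ (Fin n) → EuclideanSpace ℝ (Fin n)} {p : EuclideanSpace ℝ (Fin n)}
    (hδ : IsSignedDistance r δ) (hr : ContDiff ℝ 3 r) (hp : r p = 0) (hgrad : ∇ r p ≠ 0)
    (hb : ∀ x, IsNearestPoint {y | r y = 0} x (b x)) :
    ∀ᶠ x in 𝓝 p, ‖δ x • hessianMatrix δ (b x)‖ < 1 ∧ hessianMatrix δ x =
      hessianMatrix δ (b x) - δ x • (hessianMatrix δ (b x) * hessianMatrix δ x) := by
  have hr21 : ContDiff ℝ (2 + 1) r := by rwa [two_add_one_eq_three]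
  have hδ2 := hδ.eventually_contDiffAt hr21 two_ne_zero hp hgrad hb
  filter_upwards [hδ2, (IsNearestPoint.tendsto hb hp).eventually hδ2,
    hδ.eventually_fderiv_gradient_eq hr hp hgrad hb,
    hδ.eventually_norm_smul_fderiv_gradient_lt_one hr hp hgrad hb] with x hx hbx heq hlt
  constructor
  · rwa [Matrix.cstar_norm_def, map_smul, toEuclideanCLM_hessianMatrix hbx]
  · apply EquivLike.injective (Matrix.toEuclideanCLM (n := Fin n) (𝕜 := ℝ))
    rwa [map_sub, map_smul, map_mul, toEuclideanCLM_hessianMatrix hx,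
      toEuclideanCLM_hessianMatrix hbx]

theorem IsSignedDistance.eventually_hessianMatrix_eq_mul_tsum
    {r δ : EuclideanSpace ℝ (Fin n) → ℝ} {b : EuclideanSpace ℝ (Fin n) → EuclideanSpace ℝ (Fin n)}
    {p : EuclideanSpace ℝ (Fin n)} (hδ : IsSignedDistance r δ) (hr : ContDiff ℝ 3 r)
    (hp : r p = 0) (hgrad : ∇ r p ≠ 0) (hb : ∀ x, IsNearestPoint {y | r y = 0} x (b x)) :
    ∀ᶠ x in 𝓝 p, Summable (fun m : ℕ => (-δ x) ^ m • hessianMatrix δ (b x) ^ m) ∧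
      hessianMatrix δ x =
        hessianMatrix δ (b x) * ∑' m : ℕ, (-δ x) ^ m • hessianMatrix δ (b x) ^ m ∧
      IsUnit (1 + δ x • hessianMatrix δ (b x)) ∧
      hessianMatrix δ x = hessianMatrix δ (b x) * (1 + δ x • hessianMatrix δ (b x))⁻¹ := by
  filter_upwards [hδ.eventually_hessianMatrix_eq hr hp hgrad hb] with x ⟨hlt, heq⟩
  rw [Matrix.nonsing_inv_eq_ringInverse]
  exact eq_mul_tsum_of_eq_sub_smul_mul heq hlt

end Hessian

section SmoothlyBounded

open scoped Gradient

variable {n : ℕ} {Ω : Set (EuclideanSpace ℝ (Fin n))} {r : EuclideanSpace ℝ (Fin n) → ℝ}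

theorem abs_signedDistance (x : EuclideanSpace ℝ (Fin n)) :
    |signedDistance Ω x| = Metric.infDist x (frontier Ω) := by
  unfold signedDistance
  split_ifs <;> simp [abs_of_nonneg Metric.infDist_nonneg]

theorem isSignedDistance_signedDistance (hΩ : Ω = {x | r x < 0})
    (hfrontier : {x | r x = 0} = frontier Ω) : IsSignedDistance r (signedDistance Ω) where
  abs_eq x := by rw [abs_signedDistance, hfrontier]
  zero_le_mul x := by
    unfold signedDistance
    split_ifs with hx
    · rw [hΩ] at hx
      exact mul_nonneg_of_nonpos_of_nonpos (neg_nonpos.2 Metric.infDist_nonneg) hx.le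
    · rw [hΩ] at hx
      exact mul_nonneg Metric.infDist_nonneg (not_lt.1 hx)

theorem IsSmoothlyBounded.exists_definingFunction (hΩ : IsSmoothlyBounded Ω) :
    ∃ r : EuclideanSpace ℝ (Fin n) → ℝ, ContDiff ℝ ∞ r ∧ IsSignedDistance r (signedDistance Ω) ∧
      frontier Ω = {x | r x = 0} ∧ ∀ p, r p = 0 → ∇ r p ≠ 0 := by
  obtain ⟨-, r, hr, hneg, hzero, W, -, hW, hgrad⟩ := hΩ
  exact ⟨r, hr, isSignedDistance_signedDistance hneg hzero, hzero.symm,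
    fun p hp => hgrad p (hW hp)⟩

end SmoothlyBounded

theorem theoremT_general {n : ℕ} (Ω : Set (EuclideanSpace ℝ (Fin n))) (hΩ : IsSmoothlyBounded Ω) :
    ∃ (U : Set (EuclideanSpace ℝ (Fin n)))
      (b : EuclideanSpace ℝ (Fin n) → EuclideanSpace ℝ (Fin n)),
      IsOpen U ∧ frontier Ω ⊆ U ∧
      ContDiffOn ℝ ∞ (signedDistance Ω) U ∧
      (∀ x ∈ U, b x ∈ frontier Ω ∧ ‖b x - x‖ = |signedDistance Ω x| ∧
        ∀ p ∈ frontier Ω, ‖p - x‖ = |signedDistance Ω x| → p = b x) ∧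
      ∀ x ∈ U,
        Summable (fun m : ℕ =>
          (-signedDistance Ω x) ^ m • hessianMatrix (signedDistance Ω) (b x) ^ m) ∧
        hessianMatrix (signedDistance Ω) x =
          hessianMatrix (signedDistance Ω) (b x) *
            ∑' m : ℕ, (-signedDistance Ω x) ^ m • hessianMatrix (signedDistance Ω) (b x) ^ m ∧
        IsUnit (1 + signedDistance Ω x • hessianMatrix (signedDistance Ω) (b x)) ∧
        hessianMatrix (signedDistance Ω) x =
          hessianMatrix (signedDistance Ω) (b x) *
            (1 + signedDistance Ω x • hessianMatrix (signedDistance Ω) (b x))⁻¹ := by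
  obtain ⟨r, hr, hδ, hfrontier, hgrad⟩ := hΩ.exists_definingFunction
  obtain hempty | hne := (frontier Ω).eq_empty_or_nonempty
  · exact ⟨∅, id, isOpen_empty, hempty.subset, contDiffOn_empty, by simp, by simp⟩
  choose b hb using fun x => isClosed_frontier.exists_infDist_eq_dist hne x
  have hnear : ∀ x, IsNearestPoint {y | r y = 0} x (b x) := hfrontier ▸ hb
  have hr' : ContDiff ℝ (∞ + 1) r := hr
  have hr3 : ContDiff ℝ 3 r := mod_cast contDiff_infty.1 hr 3
  have htube : ∀ᶠ x in 𝓝ˢ (frontier Ω), _ := eventually_nhdsSet_iff_forall.2 fun p hp => by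
    rw [hfrontier] at hp
    exact (hδ.eventually_contDiffAt hr' (by simp) hp (hgrad p hp) hnear).and
      ((eventually_isNearestPoint_unique hr' (by simp) hp (hgrad p hp) hnear).and
        (hδ.eventually_hessianMatrix_eq_mul_tsum hr3 hp (hgrad p hp) hnear))
  obtain ⟨U, hU, hsub, hUtube⟩ := eventually_nhdsSet_iff_exists.1 htube
  refine ⟨U, b, hU, hsub, fun x hx => (hUtube x hx).1.contDiffWithinAt, fun x hx =>
    ⟨(hb x).1, ?_, fun p hp hpx => (hUtube x hx).2.1 p ?_⟩, fun x hx => (hUtube x hx).2.2⟩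
  · rw [abs_signedDistance, (hb x).2, dist_eq_norm']
  · rw [← hfrontier]
    exact ⟨hp, by rw [← abs_signedDistance, ← hpx, dist_eq_norm']⟩

theorem theoremT {n : ℕ} (Ω : Set (EuclideanSpace ℝ (Fin n)))
    (hΩ : IsSmoothlyBounded Ω) (hbdd : Bornology.IsBounded Ω) :
    ∃ (U : Set (EuclideanSpace ℝ (Fin n)))
      (b : EuclideanSpace ℝ (Fin n) → EuclideanSpace ℝ (Fin n)),
      IsOpen U ∧ frontier Ω ⊆ U ∧
      -- the signed distance is smooth on `U`, so its Hessian matrix is the classical one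
      ContDiffOn ℝ ∞ (signedDistance Ω) U ∧
      -- `b x` is the unique nearest boundary point of `x`
      (∀ x ∈ U, b x ∈ frontier Ω ∧ ‖b x - x‖ = |signedDistance Ω x| ∧
        ∀ p ∈ frontier Ω, ‖p - x‖ = |signedDistance Ω x| → p = b x) ∧
      ∀ x ∈ U,
        Summable (fun m : ℕ =>
          (-signedDistance Ω x) ^ m • hessianMatrix (signedDistance Ω) (b x) ^ m) ∧
        hessianMatrix (signedDistance Ω) x =
          hessianMatrix (signedDistance Ω) (b x) *
            ∑' m : ℕ, (-signedDistance Ω x) ^ m • hessianMatrix (signedDistance Ω) (b x) ^ m ∧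
        IsUnit (1 + signedDistance Ω x • hessianMatrix (signedDistance Ω) (b x)) ∧
        hessianMatrix (signedDistance Ω) x =
          hessianMatrix (signedDistance Ω) (b x) *
            (1 + signedDistance Ω x • hessianMatrix (signedDistance Ω) (b x))⁻¹ :=
  theoremT_general Ω hΩ
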